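/- Definitions. Let $X$ be a finite set, $[n]=\{1,\dots,n\}$ and $\mathbb N_p=\{0,\dots,p-1\}$. A quantum sample of a concept $c:X\to\{0,1\}$ under a probability distribution $D$ on $X$ is the state $\sum_{x\in X}\sqrt{D(x)}\,|x,c(x)\rangle$. A quantum learner using $t$ samples receives $t$ copies of the quantum sample and, by a measurement (POVM) of them, outputs a hypothesis $h:X\to\{0,1\}$. It is an $(\varepsilon,\delta)$-PAC learner for a class $\mathcal C\subseteq\{0,1\}^X$ if for every $c\in\mathcal C$ and every $D$, with probability at least $1-\delta$, the output satisfies $\Pr_{x\sim D}[h(x)\neq c(x)]\le\varepsilon$; it is proper if for every $c\in\mathcal C$ and every $D$ the output lies in $\mathcal C$ with probability $1$. For positive integers $n,k,p$ with $k \le n$, let $\mathcal C_{n,k,p}\subseteq\{0,1\}^{[n]\times\mathbb N_p}$ be the class of all functions $g_S(i,x)=\mathbf 1[i\in S]$ with $S\subseteq[n]$, $|S|=k$. For non-negative integers $k,l$ and $\delta\in(0,1/4)$ put $$t_0(k,l,\delta)=k\ln\frac{k+1}{10l+1}+k\ln(1-4\delta).$$ Statement. (0) For $n=k+d$, $k\ge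 d$ and $p\ge1$, the VC dimension of $\mathcal C_{n,k,p}$ is $d$. (1) Let $d\ge5$ be an integer, $\varepsilon\in(0,1]$, $k=\lfloor d/(5\varepsilon)\rfloor$, $n=k+d$, $l=\lfloor\varepsilon k\rfloor$, $\delta\in(0,1/4)$, and let $p$ be an integer with $p\ge k^{t_0(k,l,\delta)}/\delta^2$. Then every quantum proper $(\varepsilon,\delta)$-PAC learner for $\mathcal C_{n,k,p}$ uses at least $t_0(k,l,\delta)$ samples. (2) There are absolute constants $a>0$ and $\varepsilon_0>0$ such that the following holds for every integer $d\ge5$ and every $\varepsilon\in(0,\varepsilon_0]$. Let $k=\lfloor d/(5\varepsilon)\rfloor$, $n=k+d$, $l=\lfloor\varepsilon k\rfloor$, let $\delta\in[0,1/8]$, and let $p$ be an integer with $p\ge 64\,k^{\,k\ln((k+1)/(10l+1))}$. Then every quantum proper $(\varepsilon,\delta)$-PAC learner for $\mathcal C_{n,k,p}$ uses at least $a\,k\ln\frac{k+1}{l+1}$ samples, and at least $a\,\frac d\varepsilon\ln\frac1\varepsilon$ samples; that is, its sample complexity is $\Omega\!\left(k\log\frac{k+1}{l+1}\right)$ and $\Omega\!\left(\frac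 d\varepsilon\log\frac1\varepsilon\right)$ as $\varepsilon\to0$. -/

import Mathlib

namespace QuantumPAC

section Learning

open scoped ComplexOrder

variable {X : Type*} [Fintype X] [DecidableEq X]

/-- Amplitudes of the quantum sample `∑ₓ √(D x) |x, c x⟩` of the concept `c` under the
distribution `D`, in the computational basis of `ℂ^X ⊗ ℂ²`. -/
noncomputable def sample (c : X → Bool) (D : X → ℝ) : X × Bool → ℂ :=
  fun z => if z.2 = c z.1 then ((Real.sqrt (D z.1) : ℝ) : ℂ) else 0

/-- Amplitudes of `t` copies of the quantum sample: the `t`-fold tensor power. -/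
noncomputable def samples (t : ℕ) (c : X → Bool) (D : X → ℝ) : (Fin t → X × Bool) → ℂ :=
  fun z => ∏ j, sample c D (z j)

/-- The density operator `|ψ⟩⟨ψ|` of `t` copies of the quantum sample. -/
noncomputable def samplesDensity (t : ℕ) (c : X → Bool) (D : X → ℝ) :
    Matrix (Fin t → X × Bool) (Fin t → X × Bool) ℂ :=
  Matrix.vecMulVec (samples t c D) (star (samples t c D))

/-- Error of the hypothesis `h` for the concept `c`: the probability, for `x` distributed
according to `D`, that `h x ≠ c x`. -/
noncomputable def error (D : X → ℝ) (h c : X → Bool) : ℝ :=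
  ∑ x, if h x ≠ c x then D x else 0

variable (X) in
/-- A quantum learning algorithm over the domain `X` using `t` quantum samples: a measurement
(POVM) of the `t` samples whose outcomes are hypotheses. Since the sample oracle has no input,
every algorithm that invokes it at most `t` times, with any auxiliary registers and intermediate
measurements, induces such a measurement. -/
structure Learner (t : ℕ) where
  effect : (X → Bool) → Matrix (Fin t → X × Bool) (Fin t → X × Bool) ℂ
  posSemidef : ∀ h, (effect h).PosSemidef
  sum_effect : ∑ h, effect h = 1

namespace Learner

variable {t : ℕ}

/-- Probability that the learner outputs `h` on quantum samples of `c` under `D`. -/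
noncomputable def outputProb (A : Learner X t) (c : X → Bool) (D : X → ℝ) (h : X → Bool) : ℝ :=
  (A.effect h * samplesDensity t c D).trace.re

open Classical in
/-- Probability that the output of the learner lies in `H`. -/
noncomputable def eventProb (A : Learner X t) (c : X → Bool) (D : X → ℝ)
    (H : Set (X → Bool)) : ℝ :=
  ∑ h, if h ∈ H then A.outputProb c D h else 0

/-- `(ε, δ)`-PAC quantum learner for the concept class `C`: for every concept and every
distribution, the output is an `ε`-approximation with probability at least `1 - δ`. -/
def IsPAC (A : Learner X t) (C : Set (X → Bool)) (ε δ : ℝ) : Prop :=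
  ∀ c ∈ C, ∀ D ∈ stdSimplex ℝ X, 1 - δ ≤ A.eventProb c D {h | error D h c ≤ ε}

/-- The learner is proper for `C`: given samples of a concept of `C`, it never outputs a
hypothesis outside `C`. -/
def IsProper (A : Learner X t) (C : Set (X → Bool)) : Prop :=
  ∀ c ∈ C, ∀ D ∈ stdSimplex ℝ X, ∀ h, h ∉ C → A.outputProb c D h = 0

end Learner

end Learning

/-- The finite set `T` is shattered by the class `C`. -/
def Shatters {X : Type*} (C : Set (X → Bool)) (T : Finset X) : Prop :=
  ∀ a : X → Bool, ∃ c ∈ C, ∀ x ∈ T, c x = a x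

/-- The VC dimension of `C` is `d`: the largest size of a shattered set is `d`. -/
def HasVCDim {X : Type*} (C : Set (X → Bool)) (d : ℕ) : Prop :=
  IsGreatest {m : ℕ | ∃ T : Finset X, T.card = m ∧ Shatters C T} d

/-- The padded class over `[n] × ℕ_p`: the functions `g_S (i, x) = 1[i ∈ S]`, for `S ⊆ [n]` of
size `k`. -/
def paddedClass (n k p : ℕ) : Set (Fin n × Fin p → Bool) :=
  {g | ∃ S : Finset (Fin n), S.card = k ∧ ∀ i x, g (i, x) = decide (i ∈ S)}

/-- The bound `t₀ = k ln ((k+1)/(10l+1)) + k ln (1 - 4δ)`. -/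
noncomputable def t₀ (k l : ℕ) (δ : ℝ) : ℝ :=
  k * Real.log ((k + 1 : ℝ) / (10 * l + 1)) + k * Real.log (1 - 4 * δ)

end QuantumPAC

/-! The adversary takes `D` uniform on the points `(i, f i)`, `i ∈ S`, with `S` and the padding `f`
both uniformly random. Expand `t` samples in basis states and group these by the set `R` of indices
that occur. If the hit indicator of each occurring index is centred over its padding value, then
averaging over `f` kills every cross term between different sets `R` (`sum_centredPad_mul_eq_zero`),
while centring costs only a fraction `t / p` of the squared norm. Since the block of `R` does not
depend on `S`, the learner is reduced to a classical one that draws `t` random elements of `S` and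
knows only the set `R` it has seen.

For that learner there are two facts. If more than `10 l` elements of `S` are unseen, then for every
`T` at most a fifth of the candidates `S ⊇ R` satisfy `#(S \ T) ≤ l`, by double counting of
exchanges (`card_sdiff_swap`). And the chance that at most `10 l` elements are unseen is at most
`(10 l + 1) (1 + 1/k)^t / (k + 1)`, by Markov's inequality for the potential `1 / (unseen + 1)`
(`sum_few_unseen_le`). `success_le` combines them, with a free parameter `η` that weighs the centred
part against the error; `t₀_le` takes `η = δ`. -/

namespace QuantumPAC

open Finset

set_option linter.unusedSectionVars false

/-! ### Coupon collector: how many elements remain unseen -/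

section Coupon

variable {α : Type*} [DecidableEq α]

/-- One step of the coupon collector potential `1 / (unseen + 1)`. -/
lemma sum_potential_insert_le {S R : Finset α} (hR : R ⊆ S) :
    ∑ a ∈ S, (1 / ((#S : ℝ) - #(insert a R) + 1)) ≤
      ((#S : ℝ) + 1) * (1 / ((#S : ℝ) - #R + 1)) := by
  have hle : (#R : ℝ) ≤ #S := by exact_mod_cast card_le_card hR
  rw [← sum_sdiff hR]
  have h1 : ∑ a ∈ R, (1 / ((#S : ℝ) - #(insert a R) + 1)) = #R * (1 / ((#S : ℝ) - #R + 1)) := by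
    rw [← nsmul_eq_mul]
    refine sum_eq_card_nsmul fun a ha => ?_
    rw [insert_eq_self.2 ha]
  have h2 : ∑ a ∈ S \ R, (1 / ((#S : ℝ) - #(insert a R) + 1)) =
      ((#S : ℝ) - #R) * (1 / ((#S : ℝ) - #R)) := by
    rw [← Nat.cast_sub (card_le_card hR), ← card_sdiff_of_subset hR, ← nsmul_eq_mul]
    refine sum_eq_card_nsmul fun a ha => ?_
    rw [card_insert_of_notMem (mem_sdiff.1 ha).2, card_sdiff_of_subset hR,
      Nat.cast_sub (card_le_card hR)]
    push_cast
    congr 1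
    ring
  rw [h1, h2]
  have hpos : (0 : ℝ) < (#S : ℝ) - #R + 1 := by linarith
  -- Equal to `1` unless `R = S`, when it is `0 * (1 / 0) = 0`.
  have h3 : ((#S : ℝ) - #R) * (1 / ((#S : ℝ) - #R)) ≤ 1 := by
    rw [mul_one_div]
    exact div_self_le_one _
  have h4 : ((#S : ℝ) + 1) * (1 / ((#S : ℝ) - #R + 1)) =
      1 + #R * (1 / ((#S : ℝ) - #R + 1)) := by
    field_simp
    ring
  rw [h4]
  linarith

variable [Fintype α]

/-- The number of sequences of `t` draws from `S`. -/
lemma sum_image_subset (S : Finset α) (t : ℕ) :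
    ∑ i : Fin t → α, (if univ.image i ⊆ S then (1 : ℝ) else 0) = (#S : ℝ) ^ t := by
  rw [← sum_filter, sum_const, nsmul_eq_mul, mul_one]
  have : (univ.filter fun i : Fin t → α => univ.image i ⊆ S) = Fintype.piFinset fun _ => S := by
    ext i
    simp [image_subset_iff]
  rw [this]
  simp

/-- The expected potential after `t` draws. -/
lemma sum_potential_le (S : Finset α) (t : ℕ) :
    ∑ i : Fin t → α, (if univ.image i ⊆ S then 1 / ((#S : ℝ) - #(univ.image i) + 1) else 0) ≤
      ((#S : ℝ) + 1) ^ t / (#S + 1) := by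
  induction t with
  | zero => simp
  | succ t ih =>
    have key : ∀ i : Fin t → α, ∑ a : α, (if univ.image (Fin.cons a i : Fin (t + 1) → α) ⊆ S then
        1 / ((#S : ℝ) - #(univ.image (Fin.cons a i : Fin (t + 1) → α)) + 1) else 0) ≤
        ((#S : ℝ) + 1) *
          (if univ.image i ⊆ S then 1 / ((#S : ℝ) - #(univ.image i) + 1) else 0) := by
      intro i
      have him : ∀ a, univ.image (Fin.cons a i : Fin (t + 1) → α) = insert a (univ.image i) := by
        intro a
        ext b
        simp [Fin.exists_fin_succ, eq_comm]
      simp only [him, insert_subset_iff]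
      by_cases h : univ.image i ⊆ S
      · simp only [h, and_true, if_true]
        rw [← sum_filter, filter_mem_eq_inter, univ_inter]
        exact sum_potential_insert_le h
      · simp [h]
    rw [← (Fin.consEquiv fun _ : Fin (t + 1) => α).sum_comp, Fintype.sum_prod_type, sum_comm]
    calc _ ≤ ∑ i : Fin t → α, ((#S : ℝ) + 1) *
          (if univ.image i ⊆ S then 1 / ((#S : ℝ) - #(univ.image i) + 1) else 0) :=
        sum_le_sum fun i _ => key i
      _ ≤ ((#S : ℝ) + 1) * (((#S : ℝ) + 1) ^ t / (#S + 1)) := by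
        rw [← mul_sum]
        gcongr
      _ = _ := by ring

/-- Few sequences of `t` draws from `S` leave at most `m` elements of `S` unseen. -/
lemma sum_few_unseen_le (S : Finset α) (t m : ℕ) :
    ∑ i : Fin t → α, (if univ.image i ⊆ S ∧ #S ≤ #(univ.image i) + m then (1 : ℝ) else 0) ≤
      (m + 1) * (((#S : ℝ) + 1) ^ t / (#S + 1)) := by
  -- Markov's inequality: the potential is at least `1 / (m + 1)` on the event counted.
  refine le_trans ?_ (mul_le_mul_of_nonneg_left (sum_potential_le S t) (by positivity))
  rw [mul_sum]
  refine sum_le_sum fun i _ => ?_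
  by_cases h : univ.image i ⊆ S
  · have h1 : (#(univ.image i) : ℝ) ≤ #S := by exact_mod_cast card_le_card h
    have hpos : (0 : ℝ) < (#S : ℝ) - #(univ.image i) + 1 := by linarith
    by_cases h2 : #S ≤ #(univ.image i) + m
    · have h3 : (#S : ℝ) ≤ #(univ.image i) + m := by exact_mod_cast h2
      simp only [h, h2, and_self, if_true]
      rw [mul_one_div, le_div_iff₀ hpos]
      linarith
    · simp only [h, h2, and_false, if_false, if_true]
      positivity
  · simp [h]

end Coupon

/-! ### Exchange argument: few supersets of `R` are close to a fixed `T` -/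

section Swap

variable {α : Type*} [Fintype α] [DecidableEq α]

/-- The sets of size `k` that contain `R`. -/
def supersets (R : Finset α) (k : ℕ) : Finset (Finset α) :=
  {S ∈ powersetCard k univ | R ⊆ S}

lemma mem_supersets {R S : Finset α} {k : ℕ} : S ∈ supersets R k ↔ #S = k ∧ R ⊆ S := by
  simp [supersets, mem_powersetCard]

/-- Exchanging an element of `S ∩ T` for one outside `S ∪ T` raises `#(S \ T)` by one. -/
lemma card_sdiff_swap {R T : Finset α} {k j u d : ℕ} (hT : #T = k)
    (hα : Fintype.card α = k + d) (hR : #R + u = k) :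
    #{S ∈ supersets R k | #(S \ T) = j} * ((d - j) * (u - j)) ≤
      #{S ∈ supersets R k | #(S \ T) = j + 1} * ((j + 1) * (j + 1)) := by
  -- Double counting of exchanges. From `S` there are at least `d - j` choices of `b` and `u - j` of
  -- `s`; conversely `S` is recovered from `S'` by choosing `b ∈ S' \ T` and `s ∈ T \ S'`, at most
  -- `(j + 1)²` ways.
  refine card_mul_le_card_mul
    (fun S S' => ∃ b ∈ Tᶜ \ S, ∃ s ∈ (S ∩ T) \ R, S' = insert b (S.erase s)) ?_ ?_
  · intro S hS
    simp only [mem_filter, mem_supersets] at hS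
    obtain ⟨⟨hSk, hRS⟩, hj⟩ := hS
    have h1 : d - j ≤ #(Tᶜ \ S) := by
      have e1 := card_sdiff_add_card_inter Tᶜ S
      have e2 : Tᶜ ∩ S = S \ T := by ext; simp [and_comm]
      rw [e2, hj, card_compl, hα, hT] at e1
      omega
    have h2 : u - j ≤ #((S ∩ T) \ R) := by
      have e1 := card_sdiff_add_card_inter (S \ R) T
      have e2 : (S \ R) ∩ T = (S ∩ T) \ R := by ext; simp; tauto
      have e3 : #((S \ R) \ T) ≤ j := by
        rw [← hj]
        exact card_le_card (sdiff_subset_sdiff sdiff_subset le_rfl)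
      have e4 := card_sdiff_of_subset hRS
      rw [e2] at e1
      omega
    refine (Nat.mul_le_mul h1 h2).trans ?_
    rw [← card_product]
    refine card_le_card_of_injOn (fun x => insert x.1 (S.erase x.2)) ?_ ?_
    · rintro ⟨b, s⟩ hbs
      simp only [coe_product, Set.mem_prod, mem_coe, mem_sdiff, mem_compl, mem_inter] at hbs
      obtain ⟨⟨hbT, hbS⟩, ⟨hsS, hsT⟩, hsR⟩ := hbs
      have hb' : b ∉ S.erase s := fun h => hbS (mem_of_mem_erase h)
      simp only [mem_coe, mem_bipartiteAbove, mem_filter, mem_supersets]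
      refine ⟨⟨⟨?_, ?_⟩, ?_⟩, b, by simp [hbT, hbS], s, by simp [hsS, hsT, hsR], rfl⟩
      · rw [card_insert_of_notMem hb', card_erase_add_one hsS, hSk]
      · intro r hr
        have : r ≠ s := fun h => hsR (h ▸ hr)
        simp [this, hRS hr]
      · have : insert b (S.erase s) \ T = insert b (S \ T) := by
          ext a
          simp only [mem_sdiff, mem_insert, mem_erase]
          constructor
          · rintro ⟨h | h, h'⟩
            · exact Or.inl h
            · exact Or.inr ⟨h.2, h'⟩
          · rintro (h | h)
            · exact ⟨Or.inl h, h ▸ hbT⟩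
            · exact ⟨Or.inr ⟨fun e => h.2 (e ▸ hsT), h.1⟩, h.2⟩
        rw [this, card_insert_of_notMem (by simp [hbS]), hj]
    · rintro ⟨b, s⟩ hbs ⟨b', s'⟩ hbs' h
      simp only [coe_product, Set.mem_prod, mem_coe, mem_sdiff, mem_compl, mem_inter] at hbs hbs'
      simp only at h
      have hb : b = b' := by
        have : b ∈ insert b' (S.erase s') := h ▸ mem_insert_self _ _
        rcases mem_insert.1 this with h | h
        · exact h
        · exact absurd (mem_of_mem_erase h) hbs.1.2
      have hs : s = s' := by
        by_contra hne
        have : s ∈ insert b (S.erase s) :=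
          h ▸ mem_insert_of_mem (mem_erase.2 ⟨hne, hbs.2.1.1⟩)
        rcases mem_insert.1 this with h | h
        · exact hbs.1.2 (h ▸ hbs.2.1.1)
        · simp at h
      rw [hb, hs]
  · intro S' hS'
    simp only [mem_filter, mem_supersets] at hS'
    obtain ⟨⟨hSk, hRS⟩, hj⟩ := hS'
    have h1 : #(T \ S') = j + 1 := by
      have e1 := card_sdiff_add_card_inter T S'
      have e2 := card_sdiff_add_card_inter S' T
      rw [inter_comm] at e2
      omega
    calc _ ≤ #(((S' \ T) ×ˢ (T \ S')).image fun x => insert x.2 (S'.erase x.1)) := by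
          refine card_le_card fun S hS => ?_
          simp only [mem_bipartiteBelow, mem_filter, mem_supersets] at hS
          obtain ⟨-, b, hb, s, hs, rfl⟩ := hS
          simp only [mem_sdiff, mem_compl, mem_inter] at hb hs
          have hbs : s ≠ b := fun e => hb.2 (e ▸ hs.1.1)
          refine mem_image.2 ⟨(b, s), ?_, ?_⟩
          · simp [hb, hs, hbs]
          · have : b ∉ S.erase s := fun h => hb.2 (mem_of_mem_erase h)
            simp only [erase_insert this, insert_erase hs.1.1]
      _ ≤ _ := card_image_le.trans (by rw [card_product, h1, hj])

/-- If many elements of a random superset `S` of `R` are unknown, then `S` is rarely close to a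
given set `T`. -/
lemma card_close_supersets_le {R T : Finset α} {k l u d : ℕ} (hT : #T = k)
    (hα : Fintype.card α = k + d) (hR : #R + u = k) (hu : 10 * l + 1 ≤ u) (hd : 5 ≤ d)
    (hld : 5 * l ≤ d) :
    5 * #{S ∈ supersets R k | #(S \ T) ≤ l} ≤ #(supersets R k) := by
  have step : ∀ j ∈ range (l + 1), 5 * #{S ∈ supersets R k | #(S \ T) = j} ≤
      #{S ∈ supersets R k | #(S \ T) = j + 1} := by
    intro j hj
    have hjl : j ≤ l := by simpa [Nat.lt_succ_iff] using hj
    have h := card_sdiff_swap (j := j) hT hα hR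
    -- For `j ≥ 1`, `4 j (9 j + 1) ≥ 5 (j + 1)²`; the case `j = 0` is where `5 ≤ d` enters.
    have hnum : 5 * ((j + 1) * (j + 1)) ≤ (d - j) * (u - j) := by
      rcases Nat.eq_zero_or_pos j with rfl | hj0
      · simpa using Nat.mul_le_mul hd (by omega : 1 ≤ u)
      · have h1 : 4 * j ≤ d - j := by omega
        have h2 : 9 * j + 1 ≤ u - j := by omega
        refine le_trans ?_ (Nat.mul_le_mul h1 h2)
        nlinarith
    have h3 : (5 * #{S ∈ supersets R k | #(S \ T) = j}) * ((j + 1) * (j + 1)) ≤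
        #{S ∈ supersets R k | #(S \ T) = j + 1} * ((j + 1) * (j + 1)) := by
      refine le_trans ?_ h
      calc _ = #{S ∈ supersets R k | #(S \ T) = j} * (5 * ((j + 1) * (j + 1))) := by ring
        _ ≤ _ := Nat.mul_le_mul_left _ hnum
    exact Nat.le_of_mul_le_mul_right h3 (by positivity)
  have e1 : #{S ∈ supersets R k | #(S \ T) ≤ l} =
      ∑ j ∈ range (l + 1), #{S ∈ supersets R k | #(S \ T) = j} := by
    rw [card_eq_sum_card_fiberwise (f := fun S => #(S \ T)) (t := range (l + 1))]
    · refine sum_congr rfl fun j hj => ?_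
      rw [filter_filter]
      congr 1
      refine filter_congr fun S _ => ?_
      have := mem_range.1 hj
      constructor
      · exact fun h => h.2
      · exact fun h => ⟨by omega, h⟩
    · intro S hS
      have := (mem_filter.1 hS).2
      simpa [Nat.lt_succ_iff] using this
  rw [e1, mul_sum]
  -- Five times the levels `0, …, l` is dominated by the disjoint levels `1, …, l + 1`.
  refine (sum_le_sum step).trans ?_
  rw [← card_biUnion]
  · refine card_le_card fun S hS => ?_
    obtain ⟨j, -, hj⟩ := mem_biUnion.1 hS
    exact (mem_filter.1 hj).1
  · intro j _ j' _ hne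
    refine disjoint_left.2 fun S h h' => hne ?_
    have h1 := (mem_filter.1 h).2
    have h2 := (mem_filter.1 h').2
    omega

end Swap

/-! ### Quadratic forms of real kernels -/

section QuadraticForm

variable {Z : Type*} [Fintype Z]

/-- The quadratic form of the kernel `N` at the real vector `x`. -/
def quadForm (N : Z → Z → ℝ) (x : Z → ℝ) : ℝ := ∑ z, ∑ z', N z z' * (x z * x z')

/-- The two sides differ by `quadForm N (η • a - b) / η ≥ 0`; no symmetry of `N` is needed. -/
lemma quadForm_add_le {N : Z → Z → ℝ} (hN : ∀ x, 0 ≤ quadForm N x) (a b : Z → ℝ) {η : ℝ}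
    (hη : 0 < η) :
    quadForm N (a + b) ≤ (1 + η) * quadForm N a + (1 + 1 / η) * quadForm N b := by
  have h : quadForm N (a + b) + 1 / η * quadForm N (η • a - b) =
      (1 + η) * quadForm N a + (1 + 1 / η) * quadForm N b := by
    simp only [quadForm, mul_sum, ← sum_add_distrib]
    refine sum_congr rfl fun z _ => sum_congr rfl fun z' _ => ?_
    simp only [Pi.add_apply, Pi.sub_apply, Pi.smul_apply, smul_eq_mul]
    field_simp
    ring
  have := mul_nonneg (one_div_pos.2 hη).le (hN (η • a - b))
  linarith

lemma quadForm_const_mul (N : Z → Z → ℝ) (a : ℝ)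
    (x : Z → ℝ) : quadForm N (fun z => a * x z) = a ^ 2 * quadForm N x := by
  simp only [quadForm, mul_sum]
  exact sum_congr rfl fun z _ => sum_congr rfl fun z' _ => by ring

end QuadraticForm

/-! ### Centred padding indicators and decoherence -/

section Centred

variable {α β : Type*} [Fintype α] [DecidableEq α] [Fintype β] [DecidableEq β] {t : ℕ}

/-- The indices that occur in a basis state of `t` samples. -/
def idx (z : Fin t → (α × β) × Bool) : Finset α := univ.image fun j => (z j).1.1

/-- All labels of a basis state are `1`. -/
def Positive (z : Fin t → (α × β) × Bool) : Prop := ∀ j, (z j).2 = true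

instance (z : Fin t → (α × β) × Bool) : Decidable (Positive z) :=
  inferInstanceAs (Decidable (∀ j, (z j).2 = true))

/-- Indicator that the index `r` occurs in `z` only with the padding `y`. -/
def hit (z : Fin t → (α × β) × Bool) (r : α) (y : β) : ℝ :=
  if ∀ j, (z j).1.1 = r → (z j).1.2 = y then 1 else 0

/-- `hit z r`, made centred at the indices `r` that occur in `z`. -/
noncomputable def centredHit (z : Fin t → (α × β) × Bool) (r : α) (y : β) : ℝ :=
  if r ∈ idx z then hit z r y - (∑ y', hit z r y') / Fintype.card β else 1

/-- Indicator that the paddings of `z` are given by `f`. -/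
def pad (f : α → β) (z : Fin t → (α × β) × Bool) : ℝ := ∏ r, hit z r (f r)

/-- The centred counterpart of `pad`. -/
noncomputable def centredPad (f : α → β) (z : Fin t → (α × β) × Bool) : ℝ :=
  ∏ r, centredHit z r (f r)

lemma sum_pi_prod (g : α → β → ℝ) : ∑ f : α → β, ∏ r, g r (f r) = ∏ r, ∑ y, g r y := by
  rw [prod_univ_sum, Fintype.piFinset_univ]

lemma hit_sq (z : Fin t → (α × β) × Bool) (r : α) (y : β) : hit z r y ^ 2 = hit z r y := by
  unfold hit; split_ifs <;> simp

lemma hit_of_notMem {z : Fin t → (α × β) × Bool} {r : α} (hr : r ∉ idx z) (y : β) :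
    hit z r y = 1 := by
  unfold hit
  rw [if_pos]
  intro j hj
  exact absurd (mem_image.2 ⟨j, mem_univ _, hj⟩) hr

/-- An occurring index is compatible with at most one padding value, so the sum is `0` or `1`. -/
lemma sum_hit_sq {z : Fin t → (α × β) × Bool} {r : α} (hr : r ∈ idx z) :
    (∑ y, hit z r y) ^ 2 = ∑ y, hit z r y := by
  obtain ⟨j, -, hj⟩ := mem_image.1 hr
  have : ∑ y, hit z r y = hit z r (z j).1.2 := by
    refine sum_eq_single _ (fun y _ hy => ?_) (by simp)
    unfold hit
    rw [if_neg]
    exact fun h => hy (h j hj).symm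
  rw [this, hit_sq]

lemma sum_centredHit [Nonempty β] {z : Fin t → (α × β) × Bool} {r : α} (hr : r ∈ idx z) :
    ∑ y, centredHit z r y = 0 := by
  have : (Fintype.card β : ℝ) ≠ 0 := by exact_mod_cast Fintype.card_ne_zero
  simp only [centredHit, if_pos hr, sum_sub_distrib, sum_const, card_univ, nsmul_eq_mul]
  field_simp
  ring

/-- The factor by which centring shrinks the mass at the index `r`. -/
noncomputable def shrink (β : Type*) [Fintype β] (R : Finset α) (r : α) : ℝ :=
  if r ∈ R then 1 - 1 / Fintype.card β else 1

lemma sum_hit_mul_centredHit (z : Fin t → (α × β) × Bool) (r : α) :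
    ∑ y, hit z r y * centredHit z r y = shrink β (idx z) r * ∑ y, hit z r y ^ 2 := by
  by_cases hr : r ∈ idx z
  · simp only [centredHit, shrink, if_pos hr, mul_sub, ← sq, sum_sub_distrib, hit_sq, ← sum_mul]
    rw [mul_div_assoc', ← sq, sum_hit_sq hr]
    ring
  · simp [centredHit, shrink, if_neg hr, hit_of_notMem hr]

/-- At an occurring index, centring is the orthogonal projection onto functions of mean zero, so the
squared norm of the projection equals its inner product with `hit`. -/
lemma sum_centredHit_sq [Nonempty β] (z : Fin t → (α × β) × Bool) (r : α) :
    ∑ y, centredHit z r y ^ 2 = shrink β (idx z) r * ∑ y, hit z r y ^ 2 := by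
  by_cases hr : r ∈ idx z
  · rw [← sum_hit_mul_centredHit]
    have h : ∀ y, centredHit z r y ^ 2 = hit z r y * centredHit z r y -
        (∑ y', hit z r y') / Fintype.card β * centredHit z r y := by
      intro y
      simp only [centredHit, if_pos hr]
      ring
    simp only [h, sum_sub_distrib, ← mul_sum, sum_centredHit hr]
    ring
  · simp [centredHit, shrink, if_neg hr, hit_of_notMem hr]

lemma prod_shrink (z : Fin t → (α × β) × Bool) :
    ∏ r, shrink β (idx z) r = (1 - 1 / (Fintype.card β : ℝ)) ^ #(idx z) := by
  simp only [shrink]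
  rw [prod_ite]
  simp

lemma card_idx_le (z : Fin t → (α × β) × Bool) : #(idx z) ≤ t := by
  exact card_image_le.trans (by simp)

lemma inv_card_mem [Nonempty β] :
    0 ≤ 1 / (Fintype.card β : ℝ) ∧ 1 / (Fintype.card β : ℝ) ≤ 1 := by
  have : (1 : ℝ) ≤ Fintype.card β := by exact_mod_cast Fintype.card_pos
  exact ⟨by positivity, (div_le_one (by linarith)).2 this⟩

lemma sum_pad_mul_centredPad (z : Fin t → (α × β) × Bool) :
    ∑ f : α → β, pad f z * centredPad f z =
      (1 - 1 / (Fintype.card β : ℝ)) ^ #(idx z) * ∑ f : α → β, pad f z ^ 2 := by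
  simp only [pad, centredPad, ← prod_mul_distrib, ← prod_pow]
  rw [sum_pi_prod fun r y => hit z r y * centredHit z r y, sum_pi_prod fun r y => hit z r y ^ 2]
  simp only [sum_hit_mul_centredHit, prod_mul_distrib, prod_shrink]

lemma sum_centredPad_sq [Nonempty β] (z : Fin t → (α × β) × Bool) :
    ∑ f : α → β, centredPad f z ^ 2 =
      (1 - 1 / (Fintype.card β : ℝ)) ^ #(idx z) * ∑ f : α → β, pad f z ^ 2 := by
  simp only [pad, centredPad, ← prod_pow]
  rw [sum_pi_prod fun r y => centredHit z r y ^ 2, sum_pi_prod fun r y => hit z r y ^ 2]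
  simp only [sum_centredHit_sq, prod_mul_distrib, prod_shrink]

lemma sum_centredPad_sq_le [Nonempty β] (z : Fin t → (α × β) × Bool) :
    ∑ f : α → β, centredPad f z ^ 2 ≤ ∑ f : α → β, pad f z ^ 2 := by
  rw [sum_centredPad_sq]
  have := inv_card_mem (β := β)
  refine mul_le_of_le_one_left (sum_nonneg fun _ _ => sq_nonneg _) (pow_le_one₀ ?_ ?_) <;> linarith

/-- By Pythagoras the lost fraction is `1 - (1 - 1/p)^#(idx z)` with `p = Fintype.card β`, and
Bernoulli's inequality bounds it by `#(idx z) / p ≤ t / p`. -/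
lemma sum_pad_sub_centredPad_sq_le [Nonempty β] (z : Fin t → (α × β) × Bool) :
    ∑ f : α → β, (pad f z - centredPad f z) ^ 2 ≤
      t / Fintype.card β * ∑ f : α → β, pad f z ^ 2 := by
  have h : ∑ f : α → β, (pad f z - centredPad f z) ^ 2 =
      (1 - (1 - 1 / (Fintype.card β : ℝ)) ^ #(idx z)) * ∑ f : α → β, pad f z ^ 2 := by
    calc _ = ∑ f : α → β, pad f z ^ 2 - 2 * ∑ f : α → β, pad f z * centredPad f z +
          ∑ f : α → β, centredPad f z ^ 2 := by
          rw [mul_sum, ← sum_sub_distrib, ← sum_add_distrib]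
          exact sum_congr rfl fun f _ => by ring
      _ = _ := by
          rw [sum_pad_mul_centredPad, sum_centredPad_sq]
          ring
  rw [h]
  refine mul_le_mul_of_nonneg_right ?_ (sum_nonneg fun _ _ => sq_nonneg _)
  obtain ⟨h0, h1⟩ := inv_card_mem (β := β)
  have h2 := one_add_mul_le_pow (a := -(1 / (Fintype.card β : ℝ))) (by linarith) #(idx z)
  have h3 : (#(idx z) : ℝ) ≤ t := by exact_mod_cast card_idx_le z
  have h4 := mul_le_mul_of_nonneg_right h3 h0
  rw [← sub_eq_add_neg] at h2
  rw [div_eq_mul_one_div (t : ℝ)]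
  linarith

/-- The sum over `f` factorises over indices. At an index occurring in only one of the two states,
the other factor is `1` and the centred one sums to zero. -/
lemma sum_centredPad_mul_eq_zero [Nonempty β] {z z' : Fin t → (α × β) × Bool}
    (h : idx z ≠ idx z') : ∑ f : α → β, centredPad f z * centredPad f z' = 0 := by
  have key : ∀ z z' : Fin t → (α × β) × Bool, ∀ r ∈ idx z, r ∉ idx z' →
      ∑ f : α → β, centredPad f z * centredPad f z' = 0 := by
    intro z z' r hr hr'
    simp only [centredPad, ← prod_mul_distrib]
    rw [sum_pi_prod fun r y => centredHit z r y * centredHit z' r y]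
    refine prod_eq_zero (mem_univ r) ?_
    rw [← sum_centredHit hr]
    refine sum_congr rfl fun y _ => ?_
    rw [centredHit.eq_1 z', if_neg hr', mul_one]
  by_cases h1 : idx z ⊆ idx z'
  · obtain ⟨r, hr, hr'⟩ := not_subset.1 fun h2 => h (h1.antisymm h2)
    simp only [mul_comm (centredPad _ z)]
    exact key z' z r hr hr'
  · obtain ⟨r, hr, hr'⟩ := not_subset.1 h1
    exact key z z' r hr hr'

/-- The unnormalised amplitudes of `t` samples of `g_S` under the uniform distribution on the
points `(i, f i)`, `i ∈ S`. -/
def sampleVec (S : Finset α) (f : α → β) (z : Fin t → (α × β) × Bool) : ℝ :=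
  if idx z ⊆ S ∧ Positive z then pad f z else 0

/-- The centred counterpart of `sampleVec`. -/
noncomputable def centredVec (S : Finset α) (f : α → β) (z : Fin t → (α × β) × Bool) : ℝ :=
  if idx z ⊆ S ∧ Positive z then centredPad f z else 0

/-- The part of the centred vector in which exactly the indices of `R` occur. -/
noncomputable def blockVec (R : Finset α) (f : α → β) (z : Fin t → (α × β) × Bool) : ℝ :=
  if idx z = R ∧ Positive z then centredPad f z else 0

/-- On average over the padding, the blocks of the centred vector are incoherent. -/
lemma sum_quadForm_centredVec [Nonempty β]
    (N : (Fin t → (α × β) × Bool) → (Fin t → (α × β) × Bool) → ℝ) (S : Finset α) :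
    ∑ f : α → β, quadForm N (centredVec S f) =
      ∑ R ∈ S.powerset, ∑ f : α → β, quadForm N (blockVec R f) := by
  have hL : ∑ f : α → β, quadForm N (centredVec S f) =
      ∑ z, ∑ z', N z z' * ∑ f : α → β, centredVec S f z * centredVec S f z' := by
    simp only [quadForm, mul_sum]
    rw [sum_comm]
    exact sum_congr rfl fun z _ => sum_comm
  have hR : ∑ R ∈ S.powerset, ∑ f : α → β, quadForm N (blockVec R f) =
      ∑ z, ∑ z', N z z' * ∑ R ∈ S.powerset, ∑ f : α → β, blockVec R f z * blockVec R f z' := by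
    simp only [quadForm, mul_sum]
    rw [← sum_product', sum_comm]
    refine sum_congr rfl fun z _ => ?_
    rw [sum_comm]
    exact sum_congr rfl fun z' _ => sum_product _ _ _
  rw [hL, hR]
  refine sum_congr rfl fun z _ => sum_congr rfl fun z' _ => ?_
  congr 1
  by_cases hp : Positive z ∧ Positive z'
  · obtain ⟨hz, hz'⟩ := hp
    simp only [centredVec, blockVec, hz, hz', and_true]
    by_cases hi : idx z = idx z'
    · by_cases hS : idx z ⊆ S
      · rw [sum_eq_single (idx z)]
        · simp [← hi, hS]
        · intro R _ hR
          simp [Ne.symm hR]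
        · exact fun h => absurd (mem_powerset.2 hS) h
      · have h1 : ∀ R ∈ S.powerset, idx z ≠ R := fun R hR h => hS (h ▸ mem_powerset.1 hR)
        rw [sum_eq_zero (s := S.powerset) fun R hR => by simp [h1 R hR]]
        simp [hS]
    · have h1 : ∑ R ∈ S.powerset, ∑ f : α → β, (if idx z = R then centredPad f z else 0) *
          (if idx z' = R then centredPad f z' else 0) = 0 := by
        refine sum_eq_zero fun R _ => sum_eq_zero fun f _ => ?_
        by_cases h : idx z = R
        · have : idx z' ≠ R := fun h' => hi (h.trans h'.symm)
          simp [this]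
        · simp [h]
      rw [h1]
      by_cases hS : idx z ⊆ S ∧ idx z' ⊆ S
      · simp [hS.1, hS.2, sum_centredPad_mul_eq_zero hi]
      · refine sum_eq_zero fun f _ => ?_
        rcases not_and_or.1 hS with h | h <;> simp [h]
  · rcases not_and_or.1 hp with h | h <;> simp [centredVec, blockVec, h]

lemma pad_eq (f : α → β) (z : Fin t → (α × β) × Bool) :
    pad f z = if ∀ j, (z j).1.2 = f (z j).1.1 then 1 else 0 := by
  simp only [pad, hit, prod_ite_zero, prod_const_one]
  congr 1
  exact propext ⟨fun h j => h _ (mem_univ _) j rfl, fun h i _ j hj => hj ▸ h j⟩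

/-- The weights of a padded basis state are those of `t` independent draws. -/
lemma sum_pad_sq (f : α → β) (F : Finset α → ℝ) :
    ∑ z : Fin t → (α × β) × Bool, (if Positive z then F (idx z) * pad f z ^ 2 else 0) =
      ∑ i : Fin t → α, F (univ.image i) := by
  symm
  refine sum_of_injOn (fun i j => ((i j, f (i j)), true)) ?_ (by simp) ?_ ?_
  · intro i _ i' _ h
    funext j
    have := congrFun h j
    simp only [Prod.mk.injEq] at this
    exact this.1.1
  · intro z _ hz
    split_ifs with hpos
    · rw [pad_eq, if_neg]
      · simp
      · intro h
        refine hz ⟨fun j => (z j).1.1, by simp, ?_⟩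
        funext j
        exact Prod.ext (Prod.ext rfl (h j).symm) (hpos j).symm
    · rfl
  · intro i _
    rw [if_pos (by intro j; rfl), pad_eq, if_pos (by intro j; rfl)]
    simp [idx]

lemma sum_sampleVec_sq (S : Finset α) (f : α → β) :
    ∑ z : Fin t → (α × β) × Bool, sampleVec S f z ^ 2 = (#S : ℝ) ^ t := by
  have h := sum_pad_sq (t := t) f fun R => if R ⊆ S then 1 else 0
  calc _ = ∑ z : Fin t → (α × β) × Bool,
        (if Positive z then (if idx z ⊆ S then 1 else 0) * pad f z ^ 2 else 0) := by
        refine sum_congr rfl fun z _ => ?_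
        by_cases h1 : idx z ⊆ S <;> by_cases h2 : Positive z <;> simp [sampleVec, h1, h2]
    _ = _ := by
        rw [h, sum_image_subset]

lemma sum_sampleVec_sub_sq_le [Nonempty β] (S : Finset α) :
    ∑ f : α → β, ∑ z : Fin t → (α × β) × Bool, (sampleVec S f z - centredVec S f z) ^ 2 ≤
      t / Fintype.card β * (Fintype.card (α → β) * (#S : ℝ) ^ t) := by
  have : (Fintype.card (α → β) : ℝ) * (#S : ℝ) ^ t =
      ∑ z : Fin t → (α × β) × Bool, ∑ f : α → β, sampleVec S f z ^ 2 := by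
    rw [sum_comm]
    simp only [sum_sampleVec_sq, sum_const, card_univ, nsmul_eq_mul]
  rw [this, sum_comm, mul_sum]
  refine sum_le_sum fun z _ => ?_
  by_cases h : idx z ⊆ S ∧ Positive z
  · simp only [sampleVec, centredVec, if_pos h]
    exact sum_pad_sub_centredPad_sq_le z
  · simp [sampleVec, centredVec, if_neg h]

/-- The weight of the block `R` is at most that of the classical draws whose set of seen indices is
`R`. -/
lemma sum_blockVec_sq_le [Nonempty β] (R : Finset α) :
    ∑ f : α → β, ∑ z : Fin t → (α × β) × Bool, blockVec R f z ^ 2 ≤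
      Fintype.card (α → β) * ∑ i : Fin t → α, if univ.image i = R then 1 else 0 := by
  have h : (Fintype.card (α → β) : ℝ) * ∑ i : Fin t → α, (if univ.image i = R then 1 else 0) =
      ∑ z : Fin t → (α × β) × Bool, ∑ f : α → β,
        (if Positive z then (if idx z = R then 1 else 0) * pad f z ^ 2 else 0) := by
    rw [sum_comm]
    simp only [sum_pad_sq _ fun R' : Finset α => (if R' = R then 1 else 0 : ℝ), sum_const,
      card_univ, nsmul_eq_mul]
  rw [h, sum_comm]
  refine sum_le_sum fun z _ => ?_
  by_cases h : idx z = R ∧ Positive z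
  · simp only [blockVec, h, and_self, if_true, one_mul]
    exact sum_centredPad_sq_le z
  · have : ∀ f : α → β, blockVec R f z = 0 := fun f => by simp only [blockVec, if_neg h]
    simp only [this]
    rw [sum_eq_zero fun f _ => by simp]
    refine sum_nonneg fun f _ => ?_
    split_ifs
    · positivity
    · simp
    · exact le_rfl

end Centred

/-! ### Success averaged over concepts and paddings -/

section Average

variable {α β : Type*} [Fintype α] [DecidableEq α] [Fintype β] [DecidableEq β] {t : ℕ}

/-- Bound for the success probability of a proper learner that has seen exactly the indices `R`. -/
noncomputable def seenBound (k l : ℕ) (R : Finset α) : ℝ := if k ≤ #R + 10 * l then 1 else 1 / 5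

lemma card_close_supersets_le_seenBound {k l d : ℕ} {T : Finset α} (R : Finset α) (hT : #T = k)
    (hα : Fintype.card α = k + d) (hd : 5 ≤ d) (hld : 5 * l ≤ d) :
    (#{S ∈ supersets R k | #(S \ T) ≤ l} : ℝ) ≤ seenBound k l R * #(supersets R k) := by
  unfold seenBound
  split_ifs with h
  · rw [one_mul]
    exact_mod_cast card_filter_le _ _
  · have h1 := card_close_supersets_le (R := R) (l := l) (u := k - #R) hT hα (by omega) (by omega)
      hd hld
    have h2 : (5 : ℝ) * #{S ∈ supersets R k | #(S \ T) ≤ l} ≤ #(supersets R k) := by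
      exact_mod_cast h1
    linarith

/-- After decoherence the block of `R` no longer involves `S`, so for fixed `R` and `T` the sum over
`S` is a count of close supersets. Its bound is uniform in `T`, and completeness `hsum` then absorbs
the sum over `T`. -/
lemma sum_quadForm_centredVec_le [Nonempty β] {k l d : ℕ} (hα : Fintype.card α = k + d)
    (hd : 5 ≤ d) (hld : 5 * l ≤ d)
    {N : Finset α → (Fin t → (α × β) × Bool) → (Fin t → (α × β) × Bool) → ℝ}
    (hN : ∀ T x, 0 ≤ quadForm (N T) x)
    (hsum : ∀ x, ∑ T ∈ powersetCard k univ, quadForm (N T) x ≤ ∑ z, x z ^ 2) :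
    ∑ S ∈ powersetCard k univ, ∑ f : α → β, ∑ T ∈ powersetCard k univ with #(S \ T) ≤ l,
        quadForm (N T) (centredVec S f) ≤
      Fintype.card (α → β) * ∑ S ∈ powersetCard k univ, ∑ i : Fin t → α,
        (if univ.image i ⊆ S then seenBound k l (univ.image i) else 0) := by
  set Q : Finset α → Finset α → ℝ := fun R T => ∑ f : α → β, quadForm (N T) (blockVec R f) with hQ
  have hQ0 : ∀ R T, 0 ≤ Q R T := fun R T => sum_nonneg fun f _ => hN _ _
  have h1 : ∑ S ∈ powersetCard k univ, ∑ f : α → β, ∑ T ∈ powersetCard k univ with #(S \ T) ≤ l,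
        quadForm (N T) (centredVec S f) =
      ∑ R, ∑ T ∈ powersetCard k univ, #{S ∈ supersets R k | #(S \ T) ≤ l} * Q R T := by
    calc _ = ∑ S ∈ powersetCard k univ, ∑ T ∈ powersetCard k univ, ∑ R,
          (if R ⊆ S ∧ #(S \ T) ≤ l then Q R T else 0) := by
          refine sum_congr rfl fun S _ => ?_
          rw [sum_comm, sum_filter]
          refine sum_congr rfl fun T _ => ?_
          split_ifs with h
          · rw [sum_quadForm_centredVec]
            simp only [h, and_true]
            rw [← sum_filter]
            refine sum_congr ?_ fun _ _ => rfl
            ext R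
            simp
          · simp [h]
      _ = ∑ R, ∑ T ∈ powersetCard k univ, ∑ S ∈ powersetCard k univ,
          (if R ⊆ S ∧ #(S \ T) ≤ l then Q R T else 0) := by
          rw [sum_congr rfl fun S _ => sum_comm, sum_comm]
          exact sum_congr rfl fun R _ => sum_comm
      _ = _ := by
          refine sum_congr rfl fun R _ => sum_congr rfl fun T _ => ?_
          rw [← sum_filter, sum_const, nsmul_eq_mul, supersets, filter_filter]
  have h2 : ∀ R, ∑ T ∈ powersetCard k univ, #{S ∈ supersets R k | #(S \ T) ≤ l} * Q R T ≤
      seenBound k l R * #(supersets R k) *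
        (Fintype.card (α → β) * ∑ i : Fin t → α, if univ.image i = R then 1 else 0) := by
    intro R
    have hs : 0 ≤ seenBound k l R := by unfold seenBound; split_ifs <;> norm_num
    calc _ ≤ ∑ T ∈ powersetCard k univ, seenBound k l R * #(supersets R k) * Q R T :=
          sum_le_sum fun T hT => mul_le_mul_of_nonneg_right
            (card_close_supersets_le_seenBound R (mem_powersetCard.1 hT).2 hα hd hld) (hQ0 R T)
      _ ≤ _ := by
          rw [← mul_sum]
          refine mul_le_mul_of_nonneg_left ?_ (by positivity)
          refine le_trans ?_ (sum_blockVec_sq_le R)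
          rw [hQ, sum_comm]
          exact sum_le_sum fun f _ => hsum _
  rw [h1]
  refine (sum_le_sum fun R _ => h2 R).trans (le_of_eq ?_)
  calc _ = ∑ R : Finset α, ∑ i : Fin t → α, (if univ.image i = R then
        (Fintype.card (α → β) : ℝ) * (seenBound k l R * #(supersets R k)) else 0) := by
        refine sum_congr rfl fun R _ => ?_
        rw [mul_left_comm, ← mul_assoc, mul_sum]
        refine sum_congr rfl fun i _ => ?_
        split_ifs <;> ring
    _ = ∑ i : Fin t → α, (Fintype.card (α → β) : ℝ) *
        (seenBound k l (univ.image i) * #(supersets (univ.image i) k)) := by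
        rw [sum_comm]
        simp
    _ = _ := by
        rw [sum_comm, mul_sum]
        refine sum_congr rfl fun i _ => ?_
        rw [← sum_filter, sum_const, nsmul_eq_mul, supersets]
        ring

lemma sum_seenBound_le (S : Finset α) {l : ℕ} (t : ℕ) :
    ∑ i : Fin t → α, (if univ.image i ⊆ S then seenBound #S l (univ.image i) else 0) ≤
      (#S : ℝ) ^ t / 5 + 4 / 5 * ((10 * l + 1) * (((#S : ℝ) + 1) ^ t / (#S + 1))) := by
  have h := sum_few_unseen_le S t (10 * l)
  push_cast at h
  -- `seenBound` is `1/5` plus `4/5` of the indicator that few elements are unseen.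
  calc _ = (∑ i : Fin t → α, (if univ.image i ⊆ S then (1 : ℝ) else 0)) / 5 + 4 / 5 *
        ∑ i : Fin t → α,
          (if univ.image i ⊆ S ∧ #S ≤ #(univ.image i) + 10 * l then (1 : ℝ) else 0) := by
        rw [sum_div, mul_sum, ← sum_add_distrib]
        refine sum_congr rfl fun i _ => ?_
        unfold seenBound
        by_cases h2 : univ.image i ⊆ S <;> by_cases h3 : #S ≤ #(univ.image i) + 10 * l <;>
          simp only [h2, h3, and_self, and_true, and_false, if_true, if_false] <;> norm_num
    _ ≤ _ := by
        rw [sum_image_subset]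
        gcongr

/-- Bound for the success of a measurement on padded samples, summed over the concepts and the
paddings. -/
theorem sum_quadForm_sampleVec_le [Nonempty β] {k l d : ℕ} (hα : Fintype.card α = k + d)
    (hd : 5 ≤ d) (hld : 5 * l ≤ d)
    {N : Finset α → (Fin t → (α × β) × Bool) → (Fin t → (α × β) × Bool) → ℝ}
    (hN : ∀ T x, 0 ≤ quadForm (N T) x)
    (hsum : ∀ x, ∑ T ∈ powersetCard k univ, quadForm (N T) x ≤ ∑ z, x z ^ 2)
    {η : ℝ} (hη : 0 < η) :
    ∑ S ∈ powersetCard k univ, ∑ f : α → β, ∑ T ∈ powersetCard k univ with #(S \ T) ≤ l,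
        quadForm (N T) (sampleVec S f) ≤
      #(powersetCard k (univ : Finset α)) * Fintype.card (α → β) *
        ((1 + η) * ((k : ℝ) ^ t / 5 + 4 / 5 * ((10 * l + 1) * (((k : ℝ) + 1) ^ t / (k + 1)))) +
          (1 + 1 / η) * (t / Fintype.card β * (k : ℝ) ^ t)) := by
  have hη' : 0 ≤ 1 + 1 / η := by positivity
  have h1 : ∀ S : Finset α, ∀ f : α → β, ∑ T ∈ powersetCard k univ with #(S \ T) ≤ l,
        quadForm (N T) (sampleVec S f) ≤
      (1 + η) * (∑ T ∈ powersetCard k univ with #(S \ T) ≤ l, quadForm (N T) (centredVec S f)) +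
        (1 + 1 / η) *
          ∑ z : Fin t → (α × β) × Bool, (sampleVec S f z - centredVec S f z) ^ 2 := by
    intro S f
    set r := sampleVec (t := t) S f - centredVec S f with hr
    have hv : sampleVec S f = centredVec S f + r := by rw [hr]; abel
    calc _ ≤ ∑ T ∈ powersetCard k univ with #(S \ T) ≤ l,
          ((1 + η) * quadForm (N T) (centredVec S f) + (1 + 1 / η) * quadForm (N T) r) := by
          rw [hv]
          exact sum_le_sum fun T _ => quadForm_add_le (hN T) _ _ hη
      _ = (1 + η) * (∑ T ∈ powersetCard k univ with #(S \ T) ≤ l,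
            quadForm (N T) (centredVec S f)) +
          (1 + 1 / η) * ∑ T ∈ powersetCard k univ with #(S \ T) ≤ l, quadForm (N T) r := by
          rw [sum_add_distrib, mul_sum, mul_sum]
      _ ≤ _ := by
          gcongr
          exact (sum_le_sum_of_subset_of_nonneg (filter_subset _ _) fun T _ _ => hN T r).trans
            (hsum r)
  have h2 := sum_quadForm_centredVec_le hα hd hld hN hsum
  have h3 : ∑ S ∈ powersetCard k univ, ∑ i : Fin t → α,
      (if univ.image i ⊆ S then seenBound k l (univ.image i) else 0) ≤
      #(powersetCard k (univ : Finset α)) *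
        ((k : ℝ) ^ t / 5 + 4 / 5 * ((10 * l + 1) * (((k : ℝ) + 1) ^ t / (k + 1)))) := by
    rw [← nsmul_eq_mul]
    refine sum_le_card_nsmul _ _ _ fun S hS => ?_
    have := sum_seenBound_le S (l := l) t
    rwa [(mem_powersetCard.1 hS).2] at this
  have h4 : ∑ S ∈ powersetCard k (univ : Finset α), ∑ f : α → β,
      ∑ z : Fin t → (α × β) × Bool, (sampleVec S f z - centredVec S f z) ^ 2 ≤
      #(powersetCard k (univ : Finset α)) *
        (t / Fintype.card β * (Fintype.card (α → β) * (k : ℝ) ^ t)) := by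
    rw [← nsmul_eq_mul]
    refine sum_le_card_nsmul _ _ _ fun S hS => ?_
    have := sum_sampleVec_sub_sq_le (t := t) (β := β) S
    rwa [(mem_powersetCard.1 hS).2] at this
  calc _ ≤ _ := sum_le_sum fun S _ => sum_le_sum fun f _ => h1 S f
    _ = (1 + η) * (∑ S ∈ powersetCard k univ, ∑ f : α → β,
          ∑ T ∈ powersetCard k univ with #(S \ T) ≤ l, quadForm (N T) (centredVec S f)) +
        (1 + 1 / η) * ∑ S ∈ powersetCard k (univ : Finset α), ∑ f : α → β,
          ∑ z : Fin t → (α × β) × Bool, (sampleVec S f z - centredVec S f z) ^ 2 := by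
        simp only [sum_add_distrib, mul_sum]
    _ ≤ (1 + η) * (Fintype.card (α → β) * (#(powersetCard k (univ : Finset α)) *
          ((k : ℝ) ^ t / 5 + 4 / 5 * ((10 * l + 1) * (((k : ℝ) + 1) ^ t / (k + 1)))))) +
        (1 + 1 / η) * (#(powersetCard k (univ : Finset α)) *
          (t / Fintype.card β * (Fintype.card (α → β) * (k : ℝ) ^ t))) := by
        refine add_le_add ?_ (mul_le_mul_of_nonneg_left h4 hη')
        exact mul_le_mul_of_nonneg_left (h2.trans (mul_le_mul_of_nonneg_left h3 (by positivity)))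
          (by linarith)
    _ = _ := by ring

end Average

/-! ### From POVMs to real quadratic forms -/

section Measurement

open scoped ComplexOrder Matrix

variable {X : Type*} [Fintype X] [DecidableEq X] {t : ℕ}

/-- The real part of the effect of the outcome `h`. -/
def Learner.reEffect (A : Learner X t) (h : X → Bool) (z z' : Fin t → X × Bool) : ℝ :=
  (A.effect h z z').re

lemma Learner.quadForm_reEffect (A : Learner X t) (h : X → Bool) (x : (Fin t → X × Bool) → ℝ) :
    quadForm (A.reEffect h) x =
      (star (fun z => (x z : ℂ)) ⬝ᵥ (A.effect h *ᵥ fun z => (x z : ℂ))).re := by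
  simp only [quadForm, Learner.reEffect, dotProduct, Matrix.mulVec, Pi.star_apply, mul_sum,
    Complex.re_sum]
  refine sum_congr rfl fun z _ => sum_congr rfl fun z' _ => ?_
  simp
  ring

lemma Learner.quadForm_nonneg (A : Learner X t) (h : X → Bool) (x : (Fin t → X × Bool) → ℝ) :
    0 ≤ quadForm (A.reEffect h) x := by
  rw [A.quadForm_reEffect]
  exact (Complex.le_def.1 ((A.posSemidef h).dotProduct_mulVec_nonneg _)).1

lemma Learner.sum_quadForm (A : Learner X t) (x : (Fin t → X × Bool) → ℝ) :
    ∑ h, quadForm (A.reEffect h) x = ∑ z, x z ^ 2 := by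
  have h1 : ∀ z z', ∑ h, A.reEffect h z z' = if z = z' then 1 else 0 := by
    intro z z'
    have := congrArg (fun M => (M z z').re) A.sum_effect
    simp only [Matrix.sum_apply, Complex.re_sum, Matrix.one_apply] at this
    rw [show ∑ h, A.reEffect h z z' = ∑ h, (A.effect h z z').re from rfl, this]
    split_ifs <;> simp
  simp only [quadForm]
  rw [sum_comm]
  refine sum_congr rfl fun z _ => ?_
  rw [sum_comm]
  simp only [← sum_mul, h1]
  simp [sq]

/-- Real amplitudes make the Born rule depend only on the real parts of the effect. -/
lemma Learner.outputProb_eq (A : Learner X t) {c h : X → Bool} {D : X → ℝ}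
    {x : (Fin t → X × Bool) → ℝ} (hx : ∀ z, samples t c D z = x z) :
    A.outputProb c D h = quadForm (A.reEffect h) x := by
  simp only [Learner.outputProb, samplesDensity, Matrix.trace, Matrix.diag, Matrix.mul_apply,
    Matrix.vecMulVec_apply, Pi.star_apply, hx, quadForm, Learner.reEffect, Complex.re_sum]
  refine sum_congr rfl fun z _ => sum_congr rfl fun z' _ => ?_
  simp [mul_comm]

end Measurement

/-! ### The hard distributions -/

section Padded

variable {α β : Type*} [Fintype α] [DecidableEq α] [Fintype β] [DecidableEq β]

/-- The padded indicator function of `S`. -/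
def concept (S : Finset α) : α × β → Bool := fun z => decide (z.1 ∈ S)

/-- The uniform distribution on the points `(i, f i)` with `i ∈ S`. -/
noncomputable def padDist (S : Finset α) (f : α → β) : α × β → ℝ :=
  fun z => if z.1 ∈ S ∧ z.2 = f z.1 then 1 / (#S : ℝ) else 0

lemma padDist_mem {S : Finset α} (hS : S.Nonempty) (f : α → β) :
    padDist S f ∈ stdSimplex ℝ (α × β) := by
  constructor
  · intro z
    unfold padDist
    split_ifs <;> positivity
  · have : (#S : ℝ) ≠ 0 := by exact_mod_cast hS.card_ne_zero
    simp only [padDist, Fintype.sum_prod_type, ite_and]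
    simp only [sum_ite_irrel, sum_ite_eq', mem_univ, if_true, sum_const_zero]
    rw [← sum_filter, filter_mem_eq_inter, univ_inter, sum_const, nsmul_eq_mul]
    field_simp

lemma error_concept (S T : Finset α) (f : α → β) :
    error (padDist S f) (concept T) (concept S) = #(S \ T) / (#S : ℝ) := by
  have h : ∀ i : α, ∀ y : β, (if (concept T (i, y) : Bool) ≠ concept S (i, y) then
      padDist S f (i, y) else 0) = if i ∈ S \ T then (if y = f i then 1 / (#S : ℝ) else 0) else 0 := by
    intro i y
    by_cases h1 : i ∈ S <;> by_cases h2 : i ∈ T <;> simp [concept, padDist, h1, h2]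
  simp only [error, Fintype.sum_prod_type, h]
  simp only [sum_ite_irrel, sum_ite_eq', mem_univ, if_true, sum_const_zero]
  rw [← sum_filter, filter_mem_eq_inter, univ_inter, sum_const, nsmul_eq_mul, mul_one_div]

/-- `D` lives on `S`, where every label is `1`; this is why `sampleVec` requires `Positive`. -/
lemma samples_concept (t : ℕ) (S : Finset α) (f : α → β) (z : Fin t → (α × β) × Bool) :
    samples t (concept S) (padDist S f) z = ((√(1 / (#S : ℝ)) ^ t * sampleVec S f z : ℝ) : ℂ) := by
  have h : ∀ j, sample (concept S) (padDist S f) (z j) =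
      ((if ((z j).1.1 ∈ S ∧ (z j).2 = true) ∧ (z j).1.2 = f (z j).1.1 then √(1 / (#S : ℝ)) else 0 : ℝ)
        : ℂ) := by
    intro j
    by_cases h1 : (z j).1.1 ∈ S <;> by_cases h2 : (z j).2 = true <;>
      by_cases h3 : (z j).1.2 = f (z j).1.1 <;> simp [sample, concept, padDist, h1, h2, h3]
  simp only [samples, h, ← Complex.ofReal_prod]
  congr 1
  rw [sampleVec, pad_eq, prod_ite_zero]
  have e1 : (idx z ⊆ S ∧ Positive z) ↔ ∀ j, (z j).1.1 ∈ S ∧ (z j).2 = true := by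
    rw [forall_and, idx, image_subset_iff]
    simp [Positive]
  by_cases h1 : ∀ j, (z j).1.1 ∈ S ∧ (z j).2 = true
  · by_cases h2 : ∀ j, (z j).1.2 = f (z j).1.1
    · rw [if_pos fun j _ => ⟨h1 j, h2 j⟩, if_pos (e1.2 h1), if_pos h2]
      simp
    · rw [if_neg fun h => h2 fun j => (h j (mem_univ _)).2, if_neg h2]
      simp
  · rw [if_neg fun h => h1 fun j => (h j (mem_univ _)).1, if_neg fun h => h1 (e1.1 h)]
    simp

end Padded

/-! ### Lower bound for proper learners -/

section PaddedClass

variable {n k p t : ℕ}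

lemma concept_mem_paddedClass {S : Finset (Fin n)} (hS : #S = k) :
    concept S ∈ paddedClass n k p := ⟨S, hS, fun _ _ => rfl⟩

lemma exists_concept_of_mem {g : Fin n × Fin p → Bool} (hg : g ∈ paddedClass n k p) :
    ∃ S ∈ powersetCard k (univ : Finset (Fin n)), concept S = g := by
  obtain ⟨S, hS, h⟩ := hg
  exact ⟨S, by simp [mem_powersetCard, hS], funext fun z => (h z.1 z.2).symm⟩

lemma concept_injective [Nonempty (Fin p)] :
    Function.Injective (concept : Finset (Fin n) → Fin n × Fin p → Bool) := by
  intro S T h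
  obtain ⟨y⟩ := ‹Nonempty (Fin p)›
  ext i
  simpa [concept] using congrFun h (i, y)

/-- The success probability of a proper learner only involves outputs of the class. -/
lemma eventProb_le [Nonempty (Fin p)] {A : Learner (Fin n × Fin p) t} {ε : ℝ} (hk : 0 < k)
    (hA : A.IsProper (paddedClass n k p)) {S : Finset (Fin n)} (hS : #S = k)
    (f : Fin n → Fin p) :
    A.eventProb (concept S) (padDist S f) {h | error (padDist S f) h (concept S) ≤ ε} ≤
      (1 / (k : ℝ)) ^ t * ∑ T ∈ powersetCard k univ with #(S \ T) ≤ ⌊ε * k⌋₊,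
        quadForm (A.reEffect (concept T)) (sampleVec S f) := by
  classical
  have hk' : (0 : ℝ) < k := by exact_mod_cast hk
  have hSne : S.Nonempty := card_pos.1 (hS ▸ hk)
  have hout : ∀ h, A.outputProb (concept S) (padDist S f) h =
      (1 / (k : ℝ)) ^ t * quadForm (A.reEffect h) (sampleVec S f) := by
    intro h
    rw [A.outputProb_eq (samples_concept t S f), quadForm_const_mul, hS, ← pow_mul, mul_comm t,
      pow_mul, Real.sq_sqrt (by positivity)]
  have hprop := hA _ (concept_mem_paddedClass hS) _ (padDist_mem hSne f)
  rw [mul_sum, ← sum_image (g := concept) (s := {T ∈ powersetCard k univ | #(S \ T) ≤ ⌊ε * k⌋₊})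
    (f := fun h => (1 / (k : ℝ)) ^ t * quadForm (A.reEffect h) (sampleVec S f))
    concept_injective.injOn]
  simp only [← hout, Learner.eventProb, Set.mem_ofPred_eq]
  -- Properness removes the outputs outside the class; the others are `concept T` with `#T = k` and
  -- error `#(S \ T) / k`.
  rw [← sum_filter, ← sum_filter_add_sum_filter_not _ (· ∈ paddedClass n k p)]
  rw [sum_eq_zero (s := filter (· ∉ paddedClass n k p) _) fun h hh =>
    hprop h (mem_filter.1 hh).2, add_zero]
  refine sum_le_sum_of_subset_of_nonneg ?_ fun h _ _ => ?_
  · intro h hh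
    simp only [mem_filter, mem_univ, true_and] at hh
    obtain ⟨T, hT, rfl⟩ := exists_concept_of_mem hh.2
    refine mem_image.2 ⟨T, mem_filter.2 ⟨hT, Nat.le_floor ?_⟩, rfl⟩
    have := hh.1
    rwa [error_concept, hS, div_le_iff₀ hk'] at this
  · rw [hout]
    exact mul_nonneg (by positivity) (A.quadForm_nonneg h _)

/-- Every proper learner for the padded class satisfies the classical coupon collector bound, up
to an error that vanishes as the padding grows. -/
theorem success_le {d l : ℕ} {ε δ η : ℝ} (hd : 5 ≤ d) (hld : 5 * l ≤ d) (hl : l = ⌊ε * (k : ℝ)⌋₊)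
    (hk : 0 < k) (hp : 0 < p) {A : Learner (Fin (k + d) × Fin p) t}
    (hpac : A.IsPAC (paddedClass (k + d) k p) ε δ) (hprop : A.IsProper (paddedClass (k + d) k p))
    (hη : 0 < η) :
    1 - δ ≤ (1 + η) * (1 / 5 + 4 / 5 * ((10 * l + 1) * ((1 + 1 / (k : ℝ)) ^ t / (k + 1)))) +
      (1 + 1 / η) * (t / p) := by
  have : Nonempty (Fin p) := ⟨⟨0, hp⟩⟩
  have hk' : (0 : ℝ) < k := by exact_mod_cast hk
  have hsum : ∀ x : (Fin t → (Fin (k + d) × Fin p) × Bool) → ℝ, ∑ T ∈ powersetCard k univ,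
      quadForm (A.reEffect (concept T)) x ≤ ∑ z, x z ^ 2 := by
    intro x
    rw [← A.sum_quadForm, ← sum_image (g := concept) (s := powersetCard k univ)
      (f := fun h => quadForm (A.reEffect h) x) concept_injective.injOn]
    exact sum_le_sum_of_subset_of_nonneg (subset_univ _) fun h _ _ => A.quadForm_nonneg h x
  have hupper := sum_quadForm_sampleVec_le (α := Fin (k + d)) (β := Fin p) (t := t) (k := k)
    (by simp) hd hld (N := fun T => A.reEffect (concept T)) (fun T => A.quadForm_nonneg _) hsum hη
  set M : ℝ := #(powersetCard k (univ : Finset (Fin (k + d)))) *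
    Fintype.card (Fin (k + d) → Fin p) with hM
  have hMpos : 0 < M := by
    have h1 : 0 < #(powersetCard k (univ : Finset (Fin (k + d)))) := by
      rw [card_powersetCard]
      exact Nat.choose_pos (by simp)
    have h2 : 0 < Fintype.card (Fin (k + d) → Fin p) := Fintype.card_pos
    positivity
  have hlower : M * ((1 - δ) * (k : ℝ) ^ t) ≤ ∑ S ∈ powersetCard k univ,
      ∑ f : Fin (k + d) → Fin p, ∑ T ∈ powersetCard k univ with #(S \ T) ≤ l,
        quadForm (A.reEffect (concept T)) (sampleVec S f) := by
    rw [hM, mul_assoc, ← nsmul_eq_mul]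
    refine card_nsmul_le_sum _ _ _ fun S hS => ?_
    rw [← card_univ, ← nsmul_eq_mul]
    refine card_nsmul_le_sum _ _ _ fun f _ => ?_
    have hSk := (mem_powersetCard.1 hS).2
    have h1 := hpac _ (concept_mem_paddedClass hSk) _
      (padDist_mem (card_pos.1 (hSk ▸ hk)) f)
    have h2 := h1.trans (eventProb_le hk hprop hSk f)
    rw [← hl, one_div, inv_pow, inv_mul_eq_div, le_div_iff₀ (by positivity)] at h2
    exact h2
  have h := le_of_mul_le_mul_left (hlower.trans hupper) hMpos
  have hkt : (0 : ℝ) < (k : ℝ) ^ t := by positivity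
  refine le_of_mul_le_mul_right (h.trans (le_of_eq ?_)) hkt
  have : (1 + 1 / (k : ℝ)) ^ t = ((k : ℝ) + 1) ^ t / (k : ℝ) ^ t := by
    rw [← div_pow]
    congr 1
    field_simp
  rw [this, Fintype.card_fin]
  field_simp

/-- A proper learner uses at least `t₀` samples when the padding is large. -/
theorem t₀_le {d l : ℕ} {ε δ : ℝ} (hd : 5 ≤ d) (hε : 0 < ε) (hε1 : ε ≤ 1)
    (hkdef : k = ⌊(d : ℝ) / (5 * ε)⌋₊) (hl : l = ⌊ε * (k : ℝ)⌋₊) (hδ : 0 < δ) (hδ1 : δ < 1 / 4)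
    (hp : (k : ℝ) ^ (t₀ k l δ) / δ ^ 2 ≤ (p : ℝ)) {A : Learner (Fin (k + d) × Fin p) t}
    (hpac : A.IsPAC (paddedClass (k + d) k p) ε δ)
    (hprop : A.IsProper (paddedClass (k + d) k p)) : t₀ k l δ ≤ t := by
  by_contra! ht
  have hd' : (5 : ℝ) ≤ d := by exact_mod_cast hd
  have hk : 0 < k := by
    rw [hkdef, Nat.floor_pos, le_div_iff₀ (by positivity)]
    linarith
  have hk' : (1 : ℝ) ≤ k := by exact_mod_cast hk
  have hld : 5 * l ≤ d := by
    have h1 : (k : ℝ) ≤ d / (5 * ε) := by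
      rw [hkdef]
      exact Nat.floor_le (by positivity)
    have h2 : (l : ℝ) ≤ ε * k := by
      rw [hl]
      exact Nat.floor_le (by positivity)
    have h3 : (5 : ℝ) * l ≤ d := by
      rw [le_div_iff₀ (by positivity)] at h1
      linarith
    exact_mod_cast h3
  have hp0 : (0 : ℝ) < p := lt_of_lt_of_le (by positivity) hp
  have h := success_le (η := δ) hd hld hl hk (by exact_mod_cast hp0) hpac hprop hδ
  have hcoupon : (10 * l + 1) * ((1 + 1 / (k : ℝ)) ^ t / (k + 1)) ≤ 1 - 4 * δ := by
    have h1 : (1 + 1 / (k : ℝ)) ^ t ≤ Real.exp (t / k) := by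
      have : 1 + 1 / (k : ℝ) ≤ Real.exp (1 / k) := by
        rw [add_comm]
        exact Real.add_one_le_exp _
      refine (pow_le_pow_left₀ (by positivity) this t).trans (le_of_eq ?_)
      rw [← Real.exp_nat_mul]
      congr 1
      ring
    have h2 : (t : ℝ) / k ≤ Real.log ((k + 1 : ℝ) / (10 * l + 1)) + Real.log (1 - 4 * δ) := by
      rw [div_le_iff₀ (by linarith)]
      unfold t₀ at ht
      linarith
    have h3 : Real.exp (t / k) ≤ (k + 1 : ℝ) / (10 * l + 1) * (1 - 4 * δ) := by
      refine (Real.exp_le_exp.2 h2).trans (le_of_eq ?_)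
      rw [Real.exp_add, Real.exp_log (by positivity), Real.exp_log (by linarith)]
    have h4 := h1.trans h3
    rw [div_mul_eq_mul_div, le_div_iff₀ (by positivity)] at h4
    rw [← mul_div_assoc, div_le_iff₀ (by positivity)]
    linarith
  have hpad : (t : ℝ) / p ≤ δ ^ 2 := by
    have h1 : (t : ℝ) ≤ (k : ℝ) ^ (t₀ k l δ) := by
      rcases Nat.eq_zero_or_pos t with rfl | ht0
      · simp only [Nat.cast_zero]
        positivity
      -- For `k = 1` one has `t₀ ≤ 1`, so `t < t₀` would force `t = 0`. Otherwise `t ≤ 2^t ≤ k^t ≤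
      -- k^t₀`.
      · have hk2 : 2 ≤ k := by
          by_contra! hlt
          obtain rfl : k = 1 := by omega
          have h5 : t₀ 1 l δ ≤ 1 := by
            unfold t₀
            have h6 : Real.log (1 - 4 * δ) ≤ 0 :=
              Real.log_nonpos (by linarith) (by linarith)
            have h7 := Real.log_le_sub_one_of_pos
              (show (0 : ℝ) < ((1 : ℕ) + 1) / (10 * l + 1) by positivity)
            have h8 : (((1 : ℕ) : ℝ) + 1) / (10 * l + 1) ≤ 2 := by
              rw [div_le_iff₀ (by positivity)]
              push_cast
              have : (0 : ℝ) ≤ l := by positivity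
              linarith
            push_cast at *
            linarith
          have : (1 : ℝ) ≤ t := by exact_mod_cast ht0
          linarith
        calc (t : ℝ) ≤ (2 : ℝ) ^ t := by exact_mod_cast Nat.lt_two_pow_self.le
          _ ≤ (k : ℝ) ^ t := by
            gcongr
            exact_mod_cast hk2
          _ = (k : ℝ) ^ (t : ℝ) := (Real.rpow_natCast _ _).symm
          _ ≤ _ := Real.rpow_le_rpow_of_exponent_le hk' ht.le
    rw [div_le_iff₀ (by positivity)] at hp
    rw [div_le_iff₀ hp0]
    linarith
  have h1 : (1 + 1 / δ) * ((t : ℝ) / p) ≤ δ ^ 2 + δ := by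
    refine (mul_le_mul_of_nonneg_left hpad (by positivity)).trans (le_of_eq ?_)
    field_simp
  have h2 : (1 + δ) * (1 / 5 + 4 / 5 * ((10 * l + 1) * ((1 + 1 / (k : ℝ)) ^ t / (k + 1)))) ≤
      (1 + δ) * (1 / 5 + 4 / 5 * (1 - 4 * δ)) := by gcongr
  -- The upper bound is `(1 + δ)(1 - 16δ/5) + δ² + δ = 1 - 6δ/5 - 11δ²/5`, which is below `1 - δ`.
  nlinarith

end PaddedClass

/-! ### VC dimension -/

section VCDimension

theorem hasVCDim_paddedClass {d k p : ℕ} (hp : 0 < p) (hdk : d ≤ k) :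
    HasVCDim (paddedClass (k + d) k p) d := by
  constructor
  · refine ⟨univ.image fun j : Fin d => (Fin.natAdd k j, ⟨0, hp⟩), ?_, ?_⟩
    · rw [card_image_of_injective, card_univ, Fintype.card_fin]
      intro j j' h
      simpa using h
    · intro a
      set P : Finset (Fin (k + d)) :=
        (univ.filter fun j : Fin d => a (Fin.natAdd k j, ⟨0, hp⟩) = true).image (Fin.natAdd k)
        with hP
      have hPk : #P ≤ k := card_image_le.trans ((card_filter_le _ _).trans (by simpa using hdk))
      -- The prescribed part `P` of the last `d` indices is filled up to size `k` from the first `k`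
      -- indices; `d ≤ k` ensures `#P ≤ k`.
      obtain ⟨S, hPS, hSU, hS⟩ := exists_subsuperset_card_eq
        (s := P) (t := P ∪ univ.image (Fin.castAdd d)) subset_union_left hPk (by
          refine le_trans ?_ (card_le_card subset_union_right)
          rw [card_image_of_injective _ (Fin.castAdd_injective k d)]
          simp)
      refine ⟨concept S, concept_mem_paddedClass hS, ?_⟩
      intro x hx
      obtain ⟨j, -, rfl⟩ := mem_image.1 hx
      have : Fin.natAdd k j ∈ S ↔ a (Fin.natAdd k j, ⟨0, hp⟩) = true := by
        constructor
        · intro h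
          rcases mem_union.1 (hSU h) with h | h
          · obtain ⟨j', hj', e⟩ := mem_image.1 h
            rw [← Fin.natAdd_injective d k e]
            exact (mem_filter.1 hj').2
          · obtain ⟨i, -, e⟩ := mem_image.1 h
            have := congrArg Fin.val e
            simp at this
            omega
        · exact fun h => hPS (mem_image.2 ⟨j, by simp [h], rfl⟩)
      simp only [concept]
      by_cases h : a (Fin.natAdd k j, ⟨0, hp⟩) = true
      · simp [this, h]
      · simp [this, h]
  · rintro m ⟨T, rfl, hT⟩
    -- Labels ignore the padding, so shattered points have distinct indices. The all-zero pattern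
    -- then puts these in the complement of a `k`-set.
    have hinj : Set.InjOn Prod.fst (T : Set (Fin (k + d) × Fin p)) := by
      intro x hx y hy hxy
      by_contra hne
      obtain ⟨c, ⟨S, -, hS⟩, hc⟩ := hT fun z => decide (z = x)
      have h1 := hc x hx
      have h2 := hc y hy
      have h3 : c x = c y := (hS x.1 x.2).trans (hxy ▸ (hS y.1 y.2).symm)
      rw [h1, h2] at h3
      simp [Ne.symm hne] at h3
    obtain ⟨c, ⟨S, hSk, hS⟩, hc⟩ := hT fun _ => false
    have hdisj : Disjoint S (T.image Prod.fst) := by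
      refine disjoint_left.2 fun i hi hi' => ?_
      obtain ⟨x, hx, rfl⟩ := mem_image.1 hi'
      have h1 := hc x hx
      rw [← Prod.mk.eta (p := x), hS] at h1
      simp [hi] at h1
    have h1 := card_le_univ (S ∪ T.image Prod.fst)
    rw [card_union_of_disjoint hdisj, card_image_of_injOn hinj, hSk, Fintype.card_fin] at h1
    omega

end VCDimension

/-! ### Asymptotic form of the bound -/

section Asymptotics

theorem asymptotic_lower_bound {d k l p t : ℕ} {ε δ : ℝ} (hd : 5 ≤ d) (hε : 0 < ε)
    (hε1 : ε ≤ 1 / 800) (hkdef : k = ⌊(d : ℝ) / (5 * ε)⌋₊) (hl : l = ⌊ε * (k : ℝ)⌋₊)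
    (hδ1 : δ ≤ 1 / 8)
    (hp : 64 * (k : ℝ) ^ ((k : ℝ) * Real.log ((k + 1 : ℝ) / (10 * l + 1))) ≤ (p : ℝ))
    {A : Learner (Fin (k + d) × Fin p) t} (hpac : A.IsPAC (paddedClass (k + d) k p) ε δ)
    (hprop : A.IsProper (paddedClass (k + d) k p)) :
    1 / 40 * ((k : ℝ) * Real.log ((k + 1 : ℝ) / (l + 1))) ≤ (t : ℝ) ∧
      1 / 40 * ((d : ℝ) / ε * Real.log (1 / ε)) ≤ (t : ℝ) := by
  have hd' : (5 : ℝ) ≤ d := by exact_mod_cast hd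
  have hk1 : (d : ℝ) / (5 * ε) < k + 1 := by
    rw [hkdef]
    exact Nat.lt_floor_add_one _
  have hdε : (d : ℝ) / (5 * ε) = d / ε / 5 := by field_simp
  have hdbig : 5 * 800 ≤ (d : ℝ) / ε := by
    rw [le_div_iff₀ hε]
    nlinarith
  have hk' : (1 : ℝ) ≤ k := by linarith
  have hklow : (d : ℝ) / ε / 10 ≤ k := by linarith
  -- Weakening `δ` to `1/8` covers `δ = 0`; then `1 - 4δ = 1/2` and `1/δ² = 64`.
  have hpac' : A.IsPAC (paddedClass (k + d) k p) ε (1 / 8) := fun c hc D hD =>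
    le_trans (by linarith) (hpac c hc D hD)
  have hlog2 : Real.log (1 - 4 * (1 / 8)) = -Real.log 2 := by
    rw [← Real.log_inv]
    norm_num
  have hp' : (k : ℝ) ^ (t₀ k l (1 / 8)) / (1 / 8) ^ 2 ≤ (p : ℝ) := by
    refine le_trans ?_ hp
    have h1 : t₀ k l (1 / 8) ≤ k * Real.log ((k + 1 : ℝ) / (10 * l + 1)) := by
      have := mul_nonneg (zero_le_one.trans hk') (Real.log_nonneg one_le_two)
      rw [t₀, hlog2]
      linarith
    have h2 := Real.rpow_le_rpow_of_exponent_le hk' h1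
    norm_num
    linarith
  have ht := t₀_le hd hε (by linarith) hkdef hl (by norm_num) (by norm_num) hp' hpac' hprop
  set ρ : ℝ := (k + 1 : ℝ) / (l + 1) with hρ
  have hl0 : (0 : ℝ) ≤ l := by positivity
  -- `l + 1 ≤ ε k + 1 ≤ 2 ε (k + 1)`, because `1 ≤ d/5 < ε (k + 1)`.
  have hρlow : 1 / ε / 2 ≤ ρ := by
    have h1 : (l : ℝ) ≤ ε * k := by
      rw [hl]
      exact Nat.floor_le (by positivity)
    have h2 : 1 ≤ ε * (k + 1) := by
      rw [div_lt_iff₀ (by positivity)] at hk1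
      linarith
    rw [hρ, div_div, div_le_div_iff₀ (by positivity) (by positivity)]
    nlinarith
  have hεinv : 800 ≤ 1 / ε := by
    rw [le_div_iff₀ hε]
    linarith
  have hρ400 : 400 ≤ ρ := by linarith
  have hlogρ : Real.log (1 / ε) / 2 ≤ Real.log ρ := by
    have h1 : Real.log (1 / ε / 2) ≤ Real.log ρ := Real.log_le_log (by positivity) hρlow
    have h2 : Real.log (4 : ℝ) ≤ Real.log (1 / ε) := Real.log_le_log (by norm_num) (by linarith)
    have h3 : Real.log (4 : ℝ) = 2 * Real.log 2 := by
      rw [show (4 : ℝ) = 2 ^ 2 by norm_num, Real.log_pow]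
      norm_num
    rw [Real.log_div (by positivity) (by norm_num)] at h1
    linarith
  -- The losses `10` and `2` cost `log 20`, at most half of `log ρ` since `ρ ≥ 400 = 20²`; hence `ε
  -- ≤ 1/800`.
  have hmain : Real.log ρ / 2 ≤ Real.log ((k + 1 : ℝ) / (10 * l + 1)) - Real.log 2 := by
    have h1 : ρ / 20 ≤ (k + 1 : ℝ) / (10 * l + 1) / 2 := by
      rw [hρ, div_div, div_div]
      exact div_le_div_of_nonneg_left (by positivity) (by positivity) (by linarith)
    have h2 := Real.log_le_log (by positivity) h1
    rw [Real.log_div (x := ρ) (by positivity) (by norm_num),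
      Real.log_div (x := (k + 1 : ℝ) / (10 * l + 1)) (by positivity) (by norm_num)] at h2
    have h3 : 2 * Real.log 20 ≤ Real.log ρ := by
      have : (2 : ℝ) * Real.log 20 = Real.log 400 := by
        rw [show (400 : ℝ) = 20 ^ 2 by norm_num, Real.log_pow]
        norm_num
      rw [this]
      exact Real.log_le_log (by norm_num) hρ400
    linarith
  have hlogρ0 : 0 ≤ Real.log ρ := Real.log_nonneg (by linarith)
  have htk : k * (Real.log ρ / 2) ≤ t := by
    have h1 := mul_le_mul_of_nonneg_left hmain (zero_le_one.trans hk')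
    rw [t₀, hlog2] at ht
    linarith
  have hkρ : 0 ≤ (k : ℝ) * Real.log ρ := by positivity
  refine ⟨by linarith, ?_⟩
  have hlogε : 0 ≤ Real.log (1 / ε) := Real.log_nonneg (by linarith)
  -- With `k * log ρ ≤ 2 t` this yields the constant `1/40`.
  have h1 : (d : ℝ) / ε / 10 * (Real.log (1 / ε) / 2) ≤ k * Real.log ρ := by gcongr
  linarith

end Asymptotics

end QuantumPAC

theorem mainTheorem4 :
    -- the VC dimension of the padded class
    (∀ d k p : ℕ, 0 < p → d ≤ k →
      QuantumPAC.HasVCDim (QuantumPAC.paddedClass (k + d) k p) d) ∧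
    -- every proper learner uses at least `t₀` samples
    (∀ (d : ℕ) (ε δ : ℝ) (k l p t : ℕ), 5 ≤ d → 0 < ε → ε ≤ 1 →
      k = ⌊(d : ℝ) / (5 * ε)⌋₊ → l = ⌊ε * (k : ℝ)⌋₊ → 0 < δ → δ < 1 / 4 →
      (k : ℝ) ^ (QuantumPAC.t₀ k l δ) / δ ^ 2 ≤ (p : ℝ) →
      ∀ A : QuantumPAC.Learner (Fin (k + d) × Fin p) t,
        A.IsPAC (QuantumPAC.paddedClass (k + d) k p) ε δ →
        A.IsProper (QuantumPAC.paddedClass (k + d) k p) →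
        QuantumPAC.t₀ k l δ ≤ (t : ℝ)) ∧
    -- the asymptotic bound, with absolute constants `a` and `ε₀`
    (∃ a > (0 : ℝ), ∃ ε₀ > (0 : ℝ),
      ∀ (d : ℕ) (ε δ : ℝ) (k l p t : ℕ), 5 ≤ d → 0 < ε → ε ≤ ε₀ →
        k = ⌊(d : ℝ) / (5 * ε)⌋₊ → l = ⌊ε * (k : ℝ)⌋₊ → 0 ≤ δ → δ ≤ 1 / 8 →
        64 * (k : ℝ) ^ ((k : ℝ) * Real.log ((k + 1 : ℝ) / (10 * l + 1))) ≤ (p : ℝ) →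
        ∀ A : QuantumPAC.Learner (Fin (k + d) × Fin p) t,
          A.IsPAC (QuantumPAC.paddedClass (k + d) k p) ε δ →
          A.IsProper (QuantumPAC.paddedClass (k + d) k p) →
          a * ((k : ℝ) * Real.log ((k + 1 : ℝ) / (l + 1))) ≤ (t : ℝ) ∧
          a * ((d : ℝ) / ε * Real.log (1 / ε)) ≤ (t : ℝ)) := by
  refine ⟨fun d k p hp hdk => QuantumPAC.hasVCDim_paddedClass hp hdk, ?_, ?_⟩
  · intro d ε δ k l p t hd hε hε1 hk hl hδ hδ1 hp A hpac hprop
    exact QuantumPAC.t₀_le hd hε hε1 hk hl hδ hδ1 hp hpac hprop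
  · refine ⟨1 / 40, by norm_num, 1 / 800, by norm_num, ?_⟩
    intro d ε δ k l p t hd hε hε1 hk hl _ hδ1 hp A hpac hprop
    exact QuantumPAC.asymptotic_lower_bound hd hε hε1 hk hl hδ1 hp hpac hprop
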